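/- Let $G$ be a group, $H$ a normal subgroup of $G$ and $a\in G$ with $G=H\langle a\rangle$. For $g,x\in G$ write $[g,x]=g^{-1}x^{-1}gx$ and $[g,{}_0\,x]=g$, $[g,{}_{n+1}\,x]=[[g,{}_n\,x],x]$. Suppose that (i) $H$ is hypercentral, that is, $H$ coincides with its hypercenter, the union of all terms of its transfinite upper central series; (ii) $a$ is almost right Engel in $G$, that is, there is a finite set $R\subseteq G$ such that for every $x\in G$ one has $[a,{}_n\,x]\in R$ for all sufficiently large $n$ (depending on $x$). Then $G$ is finite-by-hypercentral: $G$ has a finite normal subgroup $N$ such that $G/N$ is hypercentral. -/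

import Mathlib

universe u

/-- The commutator `[x, y] = x⁻¹ y⁻¹ x y`. -/
def rightComm {G : Type u} [Group G] (x y : G) : G := x⁻¹ * y⁻¹ * x * y

/-- The left-normed commutator `[g, x, x, …, x]`, with `x` repeated `n` times. -/
def engelComm {G : Type u} [Group G] (g x : G) : ℕ → G
  | 0 => g
  | n + 1 => rightComm (engelComm g x n) x

/-- `R` is a right Engel sink of `g`: for every `x`, all sufficiently long commutators
`[g, x, …, x]` belong to `R`. -/
def IsRightEngelSink {G : Type u} [Group G] (g : G) (R : Set G) : Prop :=
  ∀ x : G, ∃ N : ℕ, ∀ n ≥ N, engelComm g x n ∈ R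

/-- `g` is almost right Engel: it has a finite right Engel sink. -/
def IsAlmostRightEngel {G : Type u} [Group G] (g : G) : Prop :=
  ∃ R : Set G, R.Finite ∧ IsRightEngelSink g R

/-- The terms of the transfinite upper central series of `G`, together with their normality:
`Z₀ = 1`, `Z_{α+1} / Z_α` is the center of `G / Z_α`, and `Z_α` is the union (which for a chain of
subgroups is the supremum) of the `Z_β`, `β < α`, for a limit ordinal `α`. -/
noncomputable def transfiniteUpperCentralAux (G : Type u) [Group G] (α : Ordinal.{u}) :
    {N : Subgroup G // N.Normal} :=
  Ordinal.limitRecOn (motive := fun _ => {N : Subgroup G // N.Normal}) α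
    ⟨⊥, inferInstance⟩
    (fun _ N =>
      haveI := N.2
      ⟨(Subgroup.center (G ⧸ N.1)).comap (QuotientGroup.mk' N.1), inferInstance⟩)
    (fun α _ Z =>
      ⟨⨆ β : Set.Iio α, (Z β.1 β.2).1,
        haveI : ∀ β : Set.Iio α, (Z β.1 β.2).1.Normal := fun β => (Z β.1 β.2).2
        inferInstance⟩)

/-- The `α`-th term `Z_α(G)` of the transfinite upper central series of `G`. For `G : Type u` the
series is stationary from some ordinal in `Ordinal.{u}` on. -/
noncomputable def transfiniteUpperCentral (G : Type u) [Group G] (α : Ordinal.{u}) : Subgroup G :=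
  (transfiniteUpperCentralAux G α).1

/-- The hypercenter of `G`: the union of all terms of the (ascending) transfinite upper central
series. -/
noncomputable def hypercenter (G : Type u) [Group G] : Subgroup G :=
  ⨆ α : Ordinal.{u}, transfiniteUpperCentral G α

/-- A group is hypercentral if it coincides with its hypercenter. -/
def IsHypercentral (G : Type u) [Group G] : Prop :=
  hypercenter G = ⊤

/-- A group is finite-by-hypercentral if it has a finite normal subgroup with hypercentral
quotient. -/
def IsFiniteByHypercentral (G : Type u) [Group G] : Prop :=
  ∃ (N : Subgroup G) (_ : N.Normal), Finite N ∧ IsHypercentral (G ⧸ N)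

/-! ### The transfinite upper central series and a quotient criterion for hypercentrality -/

section Series

variable {G : Type u} [Group G]

/-! The proof is by induction on the number of nontrivial elements of a finite sink `R` of `a`. Let
K be the hypercenter and suppose K ≠ G. In the centerless group G/K the center of the image of H
contains a nontrivial finite subgroup Q, normal in G/K, with Q = [Q, a]: the endomorphism v ↦ [v, a]
of that center is eventually trapped in the sink, and Q consists of its periodic points
(`exists_finite_periodic`, `IsEngelExtension.exists_finite_normal`).

Let X be the preimage of Q. Because `a` acts on X/K without trivial quotients, Schur's theorem
allows a descent along the central series to a finite `a`-invariant E with X = EK; a minimal such E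
is generated by its commutators with `a` (`exists_finite_eq_closure_rightComm`), and this forces E
to centralize K (`commute_of_eq_closure_rightComm`). Hence [E, E] is the derived subgroup of X ∩
C(K), so it is finite and normal, and it can be factored out.

Now E is abelian and E = [E, a], so its elements lie in the sink. Any quotient that kills E has a
smaller sink and is covered by induction. It remains to enclose E in a finite normal subgroup P,
generated by conjugates of E; its normality comes from the Engel condition modulo the hypercenter
(`isFiniteByHypercentral_of_abelian`). -/

instance transfiniteUpperCentral_normal (α : Ordinal.{u}) :
    (transfiniteUpperCentral G α).Normal :=
  (transfiniteUpperCentralAux G α).2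

theorem rightComm_mem_iff (N : Subgroup G) [N.Normal] (g x : G) :
    rightComm g x ∈ N ↔ (g : G ⧸ N) * x = x * g := by
  rw [← QuotientGroup.mk_mul, ← QuotientGroup.mk_mul, eq_comm, QuotientGroup.eq]
  simp [rightComm, mul_assoc]

theorem transfiniteUpperCentral_zero : transfiniteUpperCentral G 0 = ⊥ := by
  simp [transfiniteUpperCentral, transfiniteUpperCentralAux]

theorem transfiniteUpperCentral_add_one (α : Ordinal.{u}) :
    transfiniteUpperCentral G (α + 1) =
      (Subgroup.center (G ⧸ transfiniteUpperCentral G α)).comap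
        (QuotientGroup.mk' (transfiniteUpperCentral G α)) := by
  simp only [transfiniteUpperCentral, transfiniteUpperCentralAux, Ordinal.limitRecOn_add_one]
  rfl

theorem transfiniteUpperCentral_limit {α : Ordinal.{u}} (hα : Order.IsSuccLimit α) :
    transfiniteUpperCentral G α = ⨆ β : Set.Iio α, transfiniteUpperCentral G β.1 := by
  simp only [transfiniteUpperCentral, transfiniteUpperCentralAux,
    Ordinal.limitRecOn_limit _ _ _ _ hα]

theorem mem_transfiniteUpperCentral_add_one {α : Ordinal.{u}} {g : G} :
    g ∈ transfiniteUpperCentral G (α + 1) ↔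
      ∀ x, rightComm g x ∈ transfiniteUpperCentral G α := by
  rw [transfiniteUpperCentral_add_one, Subgroup.mem_comap, Subgroup.mem_center_iff]
  simp only [rightComm_mem_iff]
  constructor
  · intro h x
    exact (h x).symm
  · intro h x
    induction x using QuotientGroup.induction_on with
    | H x => exact (h x).symm

theorem rightComm_mem_of_left_mem {N : Subgroup G} (hN : N.Normal) {g : G} (hg : g ∈ N) (x : G) :
    rightComm g x ∈ N := by
  have := N.mul_mem (N.inv_mem hg) (hN.conj_mem g hg x⁻¹)
  simpa [rightComm, mul_assoc] using this

theorem transfiniteUpperCentral_mono : Monotone (transfiniteUpperCentral G) := by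
  intro β γ
  induction γ using Ordinal.limitRecOn with
  | zero => intro h; rw [nonpos_iff_eq_zero.1 h]
  | add_one γ ih =>
    intro h
    rcases h.lt_or_eq with h | rfl
    · refine (ih (Order.lt_add_one_iff.1 h)).trans fun g hg => ?_
      rw [mem_transfiniteUpperCentral_add_one]
      exact rightComm_mem_of_left_mem inferInstance hg
    · exact le_rfl
  | limit γ hγ _ =>
    intro h
    rcases h.lt_or_eq with h | rfl
    · rw [transfiniteUpperCentral_limit hγ]
      exact le_iSup (fun δ : Set.Iio γ => transfiniteUpperCentral G δ.1) ⟨β, h⟩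
    · exact le_rfl

theorem mem_transfiniteUpperCentral_limit {α : Ordinal.{u}} (hα : Order.IsSuccLimit α) {g : G} :
    g ∈ transfiniteUpperCentral G α ↔ ∃ β < α, g ∈ transfiniteUpperCentral G β := by
  have : Nonempty (Set.Iio α) := ⟨⟨0, hα.bot_lt⟩⟩
  rw [transfiniteUpperCentral_limit hα, Subgroup.mem_iSup_of_directed]
  · simp
  · exact (transfiniteUpperCentral_mono.comp (Subtype.mono_coe _)).directed_le

/-- A finite subset of a limit term lies in an earlier term. -/
theorem exists_lt_subset_transfiniteUpperCentral {α : Ordinal.{u}} (hα : Order.IsSuccLimit α)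
    {S : Set G} (hS : S.Finite) (h : S ⊆ transfiniteUpperCentral G α) :
    ∃ β < α, S ⊆ transfiniteUpperCentral G β := by
  induction S, hS using Set.Finite.induction_on with
  | empty => exact ⟨0, hα.bot_lt, by simp⟩
  | insert _ _ ih =>
    rw [Set.insert_subset_iff] at h
    obtain ⟨β, hβ, h1⟩ := ih h.2
    obtain ⟨γ, hγ, h2⟩ := (mem_transfiniteUpperCentral_limit hα).1 h.1
    refine ⟨max β γ, max_lt hβ hγ, Set.insert_subset_iff.2 ⟨?_, h1.trans ?_⟩⟩
    · exact transfiniteUpperCentral_mono (le_max_right β γ) h2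
    · exact transfiniteUpperCentral_mono (le_max_left β γ)

variable (G) in
-- The ordinals of the universe do not inject into the subgroups of `G`, so two terms of the
-- monotone series agree.
theorem exists_transfiniteUpperCentral_add_one_eq :
    ∃ α : Ordinal.{u}, transfiniteUpperCentral G (α + 1) = transfiniteUpperCentral G α := by
  have h := not_injective_of_ordinal (transfiniteUpperCentral G)
  simp only [Function.Injective, not_forall] at h
  obtain ⟨α, β, h, hne⟩ := h
  wlog hlt : α < β generalizing α β
  · exact this β α h.symm (Ne.symm hne) (lt_of_le_of_ne (not_lt.1 hlt) (Ne.symm hne))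
  refine ⟨α, le_antisymm ?_ (transfiniteUpperCentral_mono (le_add_of_nonneg_right zero_le_one))⟩
  rw [h]
  exact transfiniteUpperCentral_mono (Order.add_one_le_of_lt hlt)

variable (G) in
theorem exists_hypercenter_eq :
    ∃ α : Ordinal.{u}, hypercenter G = transfiniteUpperCentral G α ∧
      transfiniteUpperCentral G (α + 1) = transfiniteUpperCentral G α := by
  obtain ⟨α, hα⟩ := exists_transfiniteUpperCentral_add_one_eq G
  have key : ∀ β : Ordinal.{u}, transfiniteUpperCentral G β ≤ transfiniteUpperCentral G α := by
    intro β
    induction β using Ordinal.limitRecOn with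
    | zero => rw [transfiniteUpperCentral_zero]; exact bot_le
    | add_one β ih =>
      intro g hg
      rw [← hα, mem_transfiniteUpperCentral_add_one]
      exact fun x => ih (mem_transfiniteUpperCentral_add_one.1 hg x)
    | limit β hβ ih =>
      intro g hg
      obtain ⟨γ, hγ, hg⟩ := (mem_transfiniteUpperCentral_limit hβ).1 hg
      exact ih γ hγ hg
  exact ⟨α, le_antisymm (iSup_le key) (le_iSup (transfiniteUpperCentral G) α), hα⟩

instance hypercenter_normal : (hypercenter G).Normal := by
  obtain ⟨α, h, -⟩ := exists_hypercenter_eq G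
  rw [h]; infer_instance

theorem mem_hypercenter_of_rightComm_mem {g : G} (h : ∀ x, rightComm g x ∈ hypercenter G) :
    g ∈ hypercenter G := by
  obtain ⟨α, h1, h2⟩ := exists_hypercenter_eq G
  rw [h1] at h ⊢
  rw [← h2]
  exact mem_transfiniteUpperCentral_add_one.2 h

/-- Hypercentrality in terms of central elements of quotients. -/
theorem isHypercentral_iff :
    IsHypercentral G ↔ ∀ N : Subgroup G, N.Normal → N ≠ ⊤ → ∃ g ∉ N, ∀ x, rightComm g x ∈ N := by
  constructor
  · intro hG N hN hne
    obtain ⟨α, h1, -⟩ := exists_hypercenter_eq G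
    have hα : ¬ transfiniteUpperCentral G α ≤ N := by
      rw [← h1, hG, top_le_iff]; exact hne
    clear h1
    induction α using Ordinal.limitRecOn with
    | zero => simp [transfiniteUpperCentral_zero] at hα
    | add_one α ih =>
      by_cases h : transfiniteUpperCentral G α ≤ N
      · obtain ⟨g, hg, hgN⟩ := SetLike.not_le_iff_exists.1 hα
        exact ⟨g, hgN, fun x => h (mem_transfiniteUpperCentral_add_one.1 hg x)⟩
      · exact ih h
    | limit α hlim ih =>
      obtain ⟨g, hg, hgN⟩ := SetLike.not_le_iff_exists.1 hα
      obtain ⟨β, hβ, hg⟩ := (mem_transfiniteUpperCentral_limit hlim).1 hg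
      exact ih β hβ fun h => hgN (h hg)
  · intro h
    by_contra hne
    obtain ⟨g, hg, hx⟩ := h (hypercenter G) inferInstance hne
    exact hg (mem_hypercenter_of_rightComm_mem hx)

end Series

/-! ### Homomorphisms, quotients and finite-by-hypercentral groups -/

section Hom

variable {G G' : Type u} [Group G] [Group G'] (f : G →* G')

theorem relIndex_comap_mk_ne_zero (N : Subgroup G) [N.Normal] (Q : Subgroup (G ⧸ N)) [Finite Q] :
    N.relIndex (Q.comap (QuotientGroup.mk' N)) ≠ 0 := by
  have hs := QuotientGroup.mk'_surjective N
  have := Subgroup.relIndex_comap (⊥ : Subgroup (G ⧸ N)) (QuotientGroup.mk' N)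
    (Q.comap (QuotientGroup.mk' N))
  rw [MonoidHom.comap_bot, QuotientGroup.ker_mk', Subgroup.map_comap_eq_self_of_surjective hs,
    Subgroup.relIndex_bot_left] at this
  rw [this]
  exact Nat.card_pos.ne'

theorem le_comap_mk (N : Subgroup G) [N.Normal] (Q : Subgroup (G ⧸ N)) :
    N ≤ Q.comap (QuotientGroup.mk' N) := fun n hn => by
  have : (QuotientGroup.mk' N) n = 1 := (QuotientGroup.eq_one_iff n).2 hn
  rw [Subgroup.mem_comap, this]; exact Q.one_mem

theorem map_rightComm (x y : G) : f (rightComm x y) = rightComm (f x) (f y) := by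
  simp [rightComm]

theorem map_engelComm (x y : G) (n : ℕ) :
    f (engelComm x y n) = engelComm (f x) (f y) n := by
  induction n with
  | zero => rfl
  | succ n ih => simp only [engelComm, map_rightComm, ih]

variable {f} in
theorem IsHypercentral.of_surjective (hf : Function.Surjective f) (hG : IsHypercentral G) :
    IsHypercentral G' := by
  rw [isHypercentral_iff] at hG ⊢
  intro N hN hne
  obtain ⟨g, hg, hx⟩ := hG (N.comap f) inferInstance (by
    intro h
    apply hne
    rw [← Subgroup.map_comap_eq_self_of_surjective hf N, h, Subgroup.map_top_of_surjective f hf])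
  refine ⟨f g, hg, fun y => ?_⟩
  obtain ⟨x, rfl⟩ := hf y
  rw [← map_rightComm]
  exact hx x

variable {f} in
theorem transfiniteUpperCentral_le_comap (hf : Function.Surjective f) (α : Ordinal.{u}) :
    transfiniteUpperCentral G α ≤ (transfiniteUpperCentral G' α).comap f := by
  induction α using Ordinal.limitRecOn with
  | zero => rw [transfiniteUpperCentral_zero]; exact bot_le
  | add_one α ih =>
    intro g hg
    rw [Subgroup.mem_comap, mem_transfiniteUpperCentral_add_one]
    intro y
    obtain ⟨x, rfl⟩ := hf y
    rw [← map_rightComm]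
    exact ih (mem_transfiniteUpperCentral_add_one.1 hg x)
  | limit α hα ih =>
    intro g hg
    obtain ⟨β, hβ, hg⟩ := (mem_transfiniteUpperCentral_limit hα).1 hg
    exact (mem_transfiniteUpperCentral_limit hα).2 ⟨β, hβ, ih β hβ hg⟩

variable {f} in
theorem hypercenter_le_comap (hf : Function.Surjective f) :
    hypercenter G ≤ (hypercenter G').comap f :=
  iSup_le fun α => (transfiniteUpperCentral_le_comap hf α).trans
    (Subgroup.comap_mono (le_iSup (transfiniteUpperCentral G') α))

theorem isHypercentral_quotient_iff (N : Subgroup G) [N.Normal] :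
    IsHypercentral (G ⧸ N) ↔ ∀ M : Subgroup G, M.Normal → N ≤ M → M ≠ ⊤ →
      ∃ g ∉ M, ∀ x, rightComm g x ∈ M := by
  have hs := QuotientGroup.mk'_surjective N
  rw [isHypercentral_iff]
  constructor
  · intro h M hM hNM hne
    have hker : (QuotientGroup.mk' N).ker ≤ M := by rwa [QuotientGroup.ker_mk']
    obtain ⟨g, hg, hx⟩ := h (M.map (QuotientGroup.mk' N)) (hM.map _ hs) (by
      intro h
      apply hne
      rw [← Subgroup.comap_map_eq_self hker, h, Subgroup.comap_top])
    obtain ⟨g, rfl⟩ := hs g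
    refine ⟨g, fun h => hg (Subgroup.mem_map_of_mem _ h), fun x => ?_⟩
    have := hx (QuotientGroup.mk' N x)
    rw [← map_rightComm, ← Subgroup.mem_comap, Subgroup.comap_map_eq_self hker] at this
    exact this
  · intro h M hM hne
    obtain ⟨g, hg, hx⟩ := h (M.comap (QuotientGroup.mk' N)) inferInstance
      (le_comap_mk N M) (by
      intro h
      apply hne
      rw [← Subgroup.map_comap_eq_self_of_surjective hs M, h, Subgroup.map_top_of_surjective _ hs])
    refine ⟨QuotientGroup.mk' N g, hg, fun y => ?_⟩
    obtain ⟨x, rfl⟩ := hs y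
    rw [← map_rightComm]
    exact hx x

/-- If `G ⧸ N` is finite-by-hypercentral, then so is `G` relative to `N`. -/
theorem exists_normal_of_isFiniteByHypercentral_quotient (N : Subgroup G) [N.Normal]
    (h : IsFiniteByHypercentral (G ⧸ N)) :
    ∃ D : Subgroup G, D.Normal ∧ N ≤ D ∧ N.relIndex D ≠ 0 ∧
      ∀ M : Subgroup G, M.Normal → D ≤ M → M ≠ ⊤ → ∃ g ∉ M, ∀ x, rightComm g x ∈ M := by
  obtain ⟨Q, hQ, hfin, hyp⟩ := h
  have hs := QuotientGroup.mk'_surjective N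
  have hN := le_comap_mk N Q
  refine ⟨Q.comap (QuotientGroup.mk' N), inferInstance, hN, relIndex_comap_mk_ne_zero N Q, ?_⟩
  · intro M hM hDM hne
    rw [isHypercentral_quotient_iff] at hyp
    have hker : (QuotientGroup.mk' N).ker ≤ M := by
      rw [QuotientGroup.ker_mk']; exact hN.trans hDM
    obtain ⟨g, hg, hx⟩ := hyp (M.map (QuotientGroup.mk' N)) (hM.map _ hs) (by
      rw [← Subgroup.map_comap_eq_self_of_surjective hs Q]
      exact Subgroup.map_mono hDM) (by
      intro h
      apply hne
      rw [← Subgroup.comap_map_eq_self hker, h, Subgroup.comap_top])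
    obtain ⟨g, rfl⟩ := hs g
    refine ⟨g, fun h => hg (Subgroup.mem_map_of_mem _ h), fun x => ?_⟩
    have := hx (QuotientGroup.mk' N x)
    rw [← map_rightComm, ← Subgroup.mem_comap, Subgroup.comap_map_eq_self hker] at this
    exact this

theorem IsFiniteByHypercentral.of_quotient_finite (N : Subgroup G) [N.Normal] [Finite N]
    (h : IsFiniteByHypercentral (G ⧸ N)) : IsFiniteByHypercentral G := by
  obtain ⟨D, hD, hND, hi, hyp⟩ := exists_normal_of_isFiniteByHypercentral_quotient N h
  refine ⟨D, hD, ?_, (isHypercentral_quotient_iff D).2 hyp⟩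
  apply Nat.finite_of_card_ne_zero
  rw [← Subgroup.relIndex_bot_left]
  refine Subgroup.relIndex_ne_zero_trans (K := N) ?_ hi
  rw [Subgroup.relIndex_bot_left]
  exact Nat.card_pos.ne'

/-- Each commutation moves a successor term one step down, and there is no infinite descent of
ordinals. -/
theorem engelComm_mem_of_mem_hypercenter {g : G} (hg : g ∈ hypercenter G) (x : G) :
    ∃ n, ∀ m ≥ n, engelComm g x m = 1 := by
  have shift : ∀ (g : G) (n : ℕ), engelComm g x (n + 1) = engelComm (rightComm g x) x n := by
    intro g n
    induction n with
    | zero => rfl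
    | succ n ih => rw [engelComm, ih, engelComm]
  obtain ⟨α, h, -⟩ := exists_hypercenter_eq G
  rw [h] at hg
  clear h
  induction α using Ordinal.limitRecOn generalizing g with
  | zero =>
    rw [transfiniteUpperCentral_zero, Subgroup.mem_bot] at hg
    subst hg
    refine ⟨0, fun m _ => ?_⟩
    induction m with
    | zero => rfl
    | succ n ih => simp_all [engelComm, rightComm]
  | add_one α ih =>
    obtain ⟨n, hn⟩ := ih (mem_transfiniteUpperCentral_add_one.1 hg x)
    refine ⟨n + 1, fun m hm => ?_⟩
    obtain ⟨m, rfl⟩ := Nat.exists_eq_add_of_le' (by omega : 1 ≤ m)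
    rw [shift]
    exact hn m (by omega)
  | limit α hα ih =>
    obtain ⟨β, hβ, hg⟩ := (mem_transfiniteUpperCentral_limit hα).1 hg
    exact ih β hβ hg

end Hom

/-! ### Finite supplements to the hypercenter -/

section Descent

open scoped commutatorElement

variable {G : Type u} [Group G]

theorem exists_finite_transversal {C Y : Subgroup G} (h : C.relIndex Y ≠ 0) :
    ∃ S : Set G, S.Finite ∧ S ⊆ Y ∧ ∀ y ∈ Y, ∃ s ∈ S, s⁻¹ * y ∈ C := by
  have : Finite (Y ⧸ C.subgroupOf Y) := Nat.finite_of_card_ne_zero h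
  refine ⟨Set.range fun q : Y ⧸ C.subgroupOf Y => (q.out : G), Set.finite_range _, ?_, ?_⟩
  · rintro _ ⟨q, rfl⟩
    exact q.out.2
  · intro y hy
    refine ⟨_, ⟨QuotientGroup.mk (⟨y, hy⟩ : Y), rfl⟩, ?_⟩
    have := QuotientGroup.eq.1 (QuotientGroup.out_eq' (QuotientGroup.mk (⟨y, hy⟩ : Y) :
      Y ⧸ C.subgroupOf Y))
    simpa [Subgroup.mem_subgroupOf] using this

theorem finite_of_finite_map_of_finite_ker {G' : Type*} [Group G'] (f : G →* G')
    (Q : Subgroup G') [Finite Q] [Finite f.ker] : Finite (Q.comap f) := by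
  have h : ((Q.comap f : Subgroup G) : Set G).Finite := by
    refine Set.Finite.preimage' (f := f) (Set.toFinite (Q : Set G')) fun b _ => ?_
    by_cases hb : ∃ x, f x = b
    · obtain ⟨x, rfl⟩ := hb
      refine ((Set.toFinite (f.ker : Set G)).image (x * ·)).subset fun y hy => ?_
      refine ⟨x⁻¹ * y, ?_, by simp⟩
      have hy : f y = f x := hy
      simp [MonoidHom.mem_ker, hy]
    · refine Set.finite_empty.subset fun y hy => hb ⟨y, hy⟩
  exact h

/-- A consequence of Schur's theorem: the commutators with `a` of a central-by-finite subgroup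
generate a finite subgroup together with the derived subgroup. -/
theorem exists_finite_rightComm_mem {Y : Subgroup G} {a : G}
    (hY : (Subgroup.center G).relIndex Y ≠ 0) (ha : ∀ y ∈ Y, a⁻¹ * y * a ∈ Y) :
    ∃ Q ≤ Y, Finite Q ∧ (∀ q ∈ Q, a⁻¹ * q * a ∈ Q) ∧ ∀ y ∈ Y, rightComm y a ∈ Q := by
  obtain ⟨S, hS, hSY, hSc⟩ := exists_finite_transversal hY
  have hdec : ∀ y ∈ Y, ∃ s ∈ S, ∃ c ∈ Subgroup.center G, y = s * c := fun y hy => by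
    obtain ⟨s, hs, hc⟩ := hSc y hy
    exact ⟨s, hs, _, hc, by simp⟩
  have hfin : Finite (commutatorSet Y) := by
    have : (Subtype.val '' commutatorSet Y).Finite := by
      refine (hS.image2 (fun s t => ⁅s, t⁆) hS).subset ?_
      rintro _ ⟨_, ⟨x, y, rfl⟩, rfl⟩
      obtain ⟨s, hs, c, hc, hx⟩ := hdec x x.2
      obtain ⟨t, ht, d, hd, hy⟩ := hdec y y.2
      refine ⟨s, hs, t, ht, ?_⟩
      rw [Subgroup.mem_center_iff] at hc hd
      have h1 : ((⁅x, y⁆ : Y) : G) = ⁅s * c, t * d⁆ := by rw [← hx, ← hy]; rfl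
      rw [h1]
      simp only [commutatorElement_def, mul_inv_rev]
      calc s * t * s⁻¹ * t⁻¹ = s * (t * s⁻¹) * t⁻¹ := by group
        _ = s * (c * (t * d) * c⁻¹ * s⁻¹ * d⁻¹) * t⁻¹ := by
          rw [← hc, mul_inv_cancel_right, mul_assoc t, ← hd, mul_assoc t, mul_inv_cancel_right]
        _ = _ := by group
    exact (this.of_finite_image Subtype.val_injective.injOn).to_subtype
  let σ : Y →* Y :=
    { toFun := fun y => ⟨a⁻¹ * y * a, ha y y.2⟩
      map_one' := by simp
      map_mul' := fun x y => by ext; simp [mul_assoc] }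
  -- In the abelianization y ↦ y⁻¹yᵃ is a homomorphism. It kills central elements of `G`, which `a`
  -- fixes, so its range is already the image of a finite transversal.
  let δ : Y →* Abelianization Y :=
    { toFun := fun y => (Abelianization.of y)⁻¹ * Abelianization.of (σ y)
      map_one' := by simp
      map_mul' := fun x y => by
        simp only [map_mul, mul_inv_rev]
        rw [mul_comm (Abelianization.of y)⁻¹, mul_mul_mul_comm] }
  have hδ : ∀ y, δ y = (Abelianization.of y)⁻¹ * Abelianization.of (σ y) := fun _ => rfl
  have hσ : ∀ y, ((σ y : Y) : G) = a⁻¹ * y * a := fun _ => rfl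
  have : Finite δ.range := by
    have hSf : Set.Finite {y : Y | (y : G) ∈ S} := hS.preimage Subtype.val_injective.injOn
    refine ((hSf.image δ).subset ?_ : (δ.range : Set (Abelianization Y)).Finite)
    rintro _ ⟨y, rfl⟩
    obtain ⟨s, hs, c, hc, hy⟩ := hdec y y.2
    refine ⟨⟨s, hSY hs⟩, hs, ?_⟩
    have hcY : c ∈ Y := by
      have := Y.mul_mem (Y.inv_mem (hSY hs)) y.2
      rwa [hy, inv_mul_cancel_left] at this
    have h1 : y = ⟨s, hSY hs⟩ * ⟨c, hcY⟩ := Subtype.ext hy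
    have h2 : σ ⟨c, hcY⟩ = ⟨c, hcY⟩ := by
      ext
      rw [Subgroup.mem_center_iff] at hc
      rw [hσ, Subgroup.coe_mk, hc, inv_mul_cancel_right]
    have h3 : δ ⟨c, hcY⟩ = 1 := by rw [hδ, h2, inv_mul_cancel]
    rw [h1, map_mul, h3, mul_one]
  have : Finite (Abelianization.of : Y →* Abelianization Y).ker := by
    rw [Abelianization.ker_of]; infer_instance
  have : Finite (δ.range.comap Abelianization.of) := finite_of_finite_map_of_finite_ker _ _
  refine ⟨(δ.range.comap Abelianization.of).map Y.subtype, ?_, ?_, ?_, ?_⟩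
  · rintro _ ⟨q, _, rfl⟩
    exact q.2
  · exact ((Set.toFinite ((δ.range.comap Abelianization.of : Subgroup Y) : Set Y)).image _)
  · rintro _ ⟨q, ⟨y, hy⟩, rfl⟩
    refine ⟨σ q, ⟨σ y, ?_⟩, rfl⟩
    have := congrArg (Abelianization.map σ) hy
    simpa [hδ, Abelianization.map_of] using this
  · intro y hy
    refine ⟨⟨rightComm y a, ?_⟩, ⟨⟨y, hy⟩, ?_⟩, rfl⟩
    · have := Y.mul_mem (Y.inv_mem hy) (ha y hy)
      simpa [rightComm, mul_assoc] using this
    · rw [hδ, ← map_inv, ← map_mul]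
      congr 1
      ext
      simp [hσ, rightComm, mul_assoc]

theorem rightComm_mul_right_mem {N : Subgroup G} [N.Normal] {x y a : G} (h : y⁻¹ * x ∈ N)
    {z : G} (hz : z⁻¹ * rightComm x a ∈ N) : (rightComm y a)⁻¹ * z ∈ N := by
  have h1 : (y : G ⧸ N) = x := QuotientGroup.eq.2 h
  have h2 : (z : G ⧸ N) = (rightComm x a : G) := QuotientGroup.eq.2 hz
  rw [← QuotientGroup.eq, h2]
  simp [rightComm, h1]

/-- Finite sections modulo a term of the upper central series on which `a` acts without
trivial quotients are covered by finite subgroups. -/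
theorem exists_finite_of_relIndex_transfiniteUpperCentral {X : Subgroup G} {a : G}
    (hsurj : ∀ x ∈ X, ∃ y ∈ X, x⁻¹ * rightComm y a ∈ hypercenter G) (α : Ordinal.{u})
    {Y : Subgroup G} (hYX : Y ≤ X) (hY : transfiniteUpperCentral G α ≤ Y)
    (hfin : (transfiniteUpperCentral G α).relIndex Y ≠ 0) (hst : ∀ y ∈ Y, a⁻¹ * y * a ∈ Y)
    (hcov : ∀ x ∈ X, ∃ y ∈ Y, y⁻¹ * x ∈ hypercenter G) :
    ∃ E ≤ X, Finite E ∧ (∀ e ∈ E, a⁻¹ * e * a ∈ E) ∧ ∀ x ∈ X, ∃ e ∈ E, e⁻¹ * x ∈ hypercenter G := by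
  induction α using Ordinal.limitRecOn generalizing Y with
  | zero =>
    rw [transfiniteUpperCentral_zero, Subgroup.relIndex_bot_left] at hfin
    exact ⟨Y, hYX, Nat.finite_of_card_ne_zero hfin, hst, hcov⟩
  | add_one α ih =>
    set N := transfiniteUpperCentral G α with hN
    set f := QuotientGroup.mk' N with hf
    have hNY : N ≤ Y :=
      (transfiniteUpperCentral_mono (le_add_of_nonneg_right zero_le_one)).trans hY
    -- Modulo the α-th term, `Y` is central-by-finite, so the Schur argument gives a finite `Q`
    -- containing all commutators of `Y` with `a`. By `hsurj` these commutators still cover `X`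
    -- modulo the hypercenter.
    rw [transfiniteUpperCentral_add_one, Subgroup.relIndex_comap] at hfin
    obtain ⟨Q, hQY, hQ, hQst, hQ2⟩ := exists_finite_rightComm_mem (a := f a) hfin (by
      rintro _ ⟨y, hy, rfl⟩
      exact ⟨_, hst y hy, rfl⟩)
    have hle : Q.comap f ≤ Y := by
      have := Subgroup.comap_mono (f := f) hQY
      rwa [Subgroup.comap_map_eq_self (by rwa [hf, QuotientGroup.ker_mk'])] at this
    refine ih (hle.trans hYX) (le_comap_mk N Q) (relIndex_comap_mk_ne_zero N Q) ?_ ?_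
    · intro y hy
      have := hQst (f y) hy
      simpa [Subgroup.mem_comap] using this
    · intro x hx
      obtain ⟨x', hx', hc⟩ := hsurj x hx
      obtain ⟨y, hy, hyx⟩ := hcov x' hx'
      refine ⟨rightComm y a, ?_, rightComm_mul_right_mem hyx hc⟩
      rw [Subgroup.mem_comap, map_rightComm]
      exact hQ2 _ ⟨y, hy, rfl⟩
  | limit α hα ih =>
    obtain ⟨S, hS, hSY, hSc⟩ := exists_finite_transversal hfin
    have hr : ∀ y : G, ∃ s, y ∈ Y → s ∈ S ∧ s⁻¹ * y ∈ transfiniteUpperCentral G α := by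
      intro y
      by_cases hy : y ∈ Y
      · obtain ⟨s, hs, h⟩ := hSc y hy
        exact ⟨s, fun _ => ⟨hs, h⟩⟩
      · exact ⟨1, fun h => absurd h hy⟩
    choose r hr using hr
    -- That the transversal `S` is an `a`-invariant subgroup modulo the limit term is expressed by
    -- finitely many relations, one for each element of `W`. They all hold modulo an earlier term.
    let W : Set G := insert 1 (Set.image2 (· * ·) S S ∪ ((·⁻¹) '' S ∪ (fun s => a⁻¹ * s * a) '' S))
    have hW : W.Finite := ((hS.image2 _ hS).union ((hS.image _).union (hS.image _))).insert _
    have hWY : W ⊆ Y := by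
      refine Set.insert_subset Y.one_mem (Set.union_subset ?_ (Set.union_subset ?_ ?_))
      · rintro _ ⟨s, hs, t, ht, rfl⟩
        exact Y.mul_mem (hSY hs) (hSY ht)
      · rintro _ ⟨s, hs, rfl⟩
        exact Y.inv_mem (hSY hs)
      · rintro _ ⟨s, hs, rfl⟩
        exact hst s (hSY hs)
    obtain ⟨γ, hγ, hWγ⟩ := exists_lt_subset_transfiniteUpperCentral hα
      (hW.image fun w => (r w)⁻¹ * w) (by
        rintro _ ⟨w, hw, rfl⟩
        exact (hr w (hWY hw)).2)
    have hrW : ∀ w ∈ W, ((r w : G) : G ⧸ transfiniteUpperCentral G γ) = w := fun w hw =>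
      QuotientGroup.eq.2 (hWγ ⟨w, hw, rfl⟩)
    set f := QuotientGroup.mk' (transfiniteUpperCentral G γ) with hf
    have hmem : ∀ w ∈ W, f w ∈ f '' S := fun w hw => ⟨r w, (hr w (hWY hw)).1, hrW w hw⟩
    let Q : Subgroup (G ⧸ transfiniteUpperCentral G γ) :=
      { carrier := f '' S
        one_mem' := by
          rw [← map_one f]
          exact hmem 1 (Set.mem_insert _ _)
        mul_mem' := by
          rintro _ _ ⟨s, hs, rfl⟩ ⟨t, ht, rfl⟩
          rw [← map_mul]
          exact hmem _ (Or.inr (Or.inl ⟨s, hs, t, ht, rfl⟩))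
        inv_mem' := by
          rintro _ ⟨s, hs, rfl⟩
          rw [← map_inv]
          exact hmem _ (Or.inr (Or.inr (Or.inl ⟨s, hs, rfl⟩))) }
    have : Finite Q := hS.image f
    have hγα := transfiniteUpperCentral_mono (G := G) hγ.le
    refine ih γ hγ (Y := Q.comap f) ?_ (le_comap_mk _ Q) (relIndex_comap_mk_ne_zero _ Q) ?_ ?_
    · rintro y ⟨s, hs, h⟩
      have h := hY (hγα (QuotientGroup.eq.1 h))
      have := Y.mul_mem (hSY hs) h
      rw [mul_inv_cancel_left] at this
      exact hYX this
    · rintro y ⟨s, hs, h⟩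
      rw [Subgroup.mem_comap, map_mul, map_mul, ← h, ← map_mul, ← map_mul]
      exact hmem _ (Or.inr (Or.inr (Or.inr ⟨s, hs, rfl⟩)))
    · intro x hx
      obtain ⟨y, hy, hyx⟩ := hcov x hx
      obtain ⟨s, hs, hsy⟩ := hSc y hy
      refine ⟨s, ⟨s, hs, rfl⟩, ?_⟩
      have := (hypercenter G).mul_mem (le_iSup (transfiniteUpperCentral G) α hsy) hyx
      simpa [mul_assoc] using this

theorem exists_finite_eq_closure_rightComm {X : Subgroup G} {a : G} (hX : hypercenter G ≤ X)
    (hsurj : ∀ x ∈ X, ∃ y ∈ X, x⁻¹ * rightComm y a ∈ hypercenter G)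
    (hfin : (hypercenter G).relIndex X ≠ 0) (hst : ∀ x ∈ X, a⁻¹ * x * a ∈ X) :
    ∃ E ≤ X, Finite E ∧ (∀ e ∈ E, a⁻¹ * e * a ∈ E) ∧
      (∀ x ∈ X, ∃ e ∈ E, e⁻¹ * x ∈ hypercenter G) ∧
      Subgroup.closure ((rightComm · a) '' (E : Set G)) = E := by
  obtain ⟨α, h, -⟩ := exists_hypercenter_eq G
  have hex : ∃ n, ∃ E ≤ X, Finite E ∧ (∀ e ∈ E, a⁻¹ * e * a ∈ E) ∧
      (∀ x ∈ X, ∃ e ∈ E, e⁻¹ * x ∈ hypercenter G) ∧ Nat.card E = n := by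
    obtain ⟨E, h1, h2, h3, h4⟩ := exists_finite_of_relIndex_transfiniteUpperCentral hsurj α
      (le_refl X) (h ▸ hX) (h ▸ hfin) hst fun x hx => ⟨x, hx, by simp [one_mem]⟩
    exact ⟨_, E, h1, h2, h3, h4, rfl⟩
  classical
  obtain ⟨E, h1, h2, h3, h4, h5⟩ := Nat.find_spec hex
  refine ⟨E, h1, h2, h3, h4, ?_⟩
  -- `E` has minimal order among admissible subgroups, and `E'` is again admissible, so the two
  -- coincide.
  set E' := Subgroup.closure ((rightComm · a) '' (E : Set G)) with hE'
  have hle : E' ≤ E := by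
    rw [hE', Subgroup.closure_le]
    rintro _ ⟨e, he, rfl⟩
    have := E.mul_mem (E.inv_mem he) (h3 e he)
    simpa [rightComm, mul_assoc] using this
  have hfin' : Finite E' := (Set.toFinite (E : Set G)).subset hle
  refine Subgroup.eq_of_le_of_card_ge hle ?_
  rw [h5]
  refine Nat.find_min' hex ⟨E', hle.trans h1, hfin', ?_, ?_, rfl⟩
  · intro e he
    refine Subgroup.closure_induction (p := fun e _ => a⁻¹ * e * a ∈ E') ?_ ?_ ?_ ?_ he
    · rintro _ ⟨e, he, rfl⟩
      refine Subgroup.subset_closure ⟨_, h3 e he, ?_⟩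
      simp [rightComm, mul_assoc]
    · simp [one_mem]
    · intro x y _ _ hx hy
      simpa [mul_assoc] using E'.mul_mem hx hy
    · intro x _ hx
      simpa [mul_assoc] using E'.inv_mem hx
  · intro x hx
    obtain ⟨x', hx', hc⟩ := hsurj x hx
    obtain ⟨e, he, hex⟩ := h4 x' hx'
    exact ⟨rightComm e a, Subgroup.subset_closure ⟨e, he, rfl⟩, rightComm_mul_right_mem hex hc⟩

/-- Commutation with `a` pushes `B` down through successor terms, while finiteness takes it below
limit terms. -/
theorem eq_bot_of_le_closure_rightComm {B : Subgroup G} [hB : Finite B] {a : G}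
    (h : B ≤ Subgroup.closure ((rightComm · a) '' (B : Set G))) {α : Ordinal.{u}}
    (hα : B ≤ transfiniteUpperCentral G α) : B = ⊥ := by
  induction α using Ordinal.limitRecOn with
  | zero => rwa [transfiniteUpperCentral_zero, le_bot_iff] at hα
  | add_one α ih =>
    refine ih (h.trans ((Subgroup.closure_le _).2 ?_))
    rintro _ ⟨b, hb, rfl⟩
    exact mem_transfiniteUpperCentral_add_one.1 (hα hb) a
  | limit α hlim ih =>
    obtain ⟨β, hβ, h⟩ := exists_lt_subset_transfiniteUpperCentral hlim
      (Set.toFinite (B : Set G)) hα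
    exact ih β hβ h

/-- A finite subgroup generated by its commutators with `a` centralizes the hypercenter. -/
theorem commute_of_eq_closure_rightComm {E : Subgroup G} [Finite E] {a : G}
    (hst : ∀ e ∈ E, a⁻¹ * e * a ∈ E)
    (hE : Subgroup.closure ((rightComm · a) '' (E : Set G)) = E) {z : G}
    (hz : z ∈ hypercenter G) {e : G} (he : e ∈ E) : e * z = z * e := by
  obtain ⟨α, h, -⟩ := exists_hypercenter_eq G
  rw [h] at hz
  clear h
  induction α using Ordinal.limitRecOn generalizing z e with
  | zero =>
    rw [transfiniteUpperCentral_zero, Subgroup.mem_bot] at hz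
    simp [hz]
  | limit α hα ih =>
    obtain ⟨β, hβ, hz⟩ := (mem_transfiniteUpperCentral_limit hα).1 hz
    exact ih β hβ he hz
  | add_one α ih =>
    have hzα : ∀ q, rightComm q z ∈ transfiniteUpperCentral G α := fun q => by
      have := inv_mem (mem_transfiniteUpperCentral_add_one.1 hz q)
      simpa [rightComm, mul_assoc] using this
    have hmul : ∀ q ∈ E, ∀ q' ∈ E, rightComm (q * q') z = rightComm q z * rightComm q' z := by
      intro q _ q' hq'
      have h1 : rightComm (q * q') z = q'⁻¹ * (rightComm q z * q') * rightComm q' z := by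
        simp [rightComm, mul_assoc]
      rw [h1, ← ih hq' (hzα q), inv_mul_cancel_left]
    -- By induction `E` centralizes the α-th term, which contains all [q, z], so q ↦ [q, z] is
    -- multiplicative. It also intertwines commutation with `a`, so its range inherits generation by
    -- commutators with `a` and is therefore trivial.
    let θ : E →* G :=
      { toFun := fun q => rightComm (q : G) z
        map_one' := by simp [rightComm]
        map_mul' := fun q q' => hmul q q.2 q' q'.2 }
    have hθa : ∀ q ∈ E, rightComm (rightComm q a) z = rightComm (rightComm q z) a := by
      intro q hq
      -- Conjugating `z` by `a⁻¹` changes it only by a factor from the α-th term, which commutes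
      -- with `E`.
      have hc : a * z * a⁻¹ * z⁻¹ ∈ transfiniteUpperCentral G α := by
        have := (inferInstance : (transfiniteUpperCentral G α).Normal).conj_mem _
          (hzα a) a
        have h2 := (inferInstance : (transfiniteUpperCentral G α).Normal).conj_mem _
          (inv_mem this) z
        convert inv_mem h2 using 1
        simp [rightComm, mul_assoc]
      have h1 : q⁻¹ * (a * z * a⁻¹ * z⁻¹) * q = a * z * a⁻¹ * z⁻¹ := by
        rw [mul_assoc, ← ih hq hc, inv_mul_cancel_left]
      have h2 : rightComm (a⁻¹ * q * a) z = a⁻¹ * rightComm q z * a := by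
        have e1 : rightComm (a⁻¹ * q * a) z =
            a⁻¹ * (q⁻¹ * ((a * z * a⁻¹ * z⁻¹)  * z)⁻¹ * q * ((a * z * a⁻¹ * z⁻¹) * z)) * a := by
          simp [rightComm, mul_assoc]
        have e2 : q⁻¹ * ((a * z * a⁻¹ * z⁻¹)  * z)⁻¹ * q * ((a * z * a⁻¹ * z⁻¹) * z) =
            q⁻¹ * z⁻¹ * q * (q⁻¹ * (a * z * a⁻¹ * z⁻¹) * q)⁻¹ * (a * z * a⁻¹ * z⁻¹) * z := by
          group
        rw [e1, e2, h1]
        simp [rightComm, mul_assoc]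
      have h3 : rightComm q a = q⁻¹ * (a⁻¹ * q * a) := by simp [rightComm, mul_assoc]
      rw [h3, hmul _ (E.inv_mem hq) _ (hst q hq), h2]
      have h4 : rightComm q⁻¹ z = (rightComm q z)⁻¹ := by
        rw [eq_inv_iff_mul_eq_one, ← hmul _ (E.inv_mem hq) _ hq]
        simp [rightComm]
      rw [h4]
      simp [rightComm, mul_assoc]
    have hB : θ.range = ⊥ := by
      have : Finite θ.range := Set.finite_range θ
      refine eq_bot_of_le_closure_rightComm (a := a) (α := α) ?_ ?_
      · rintro _ ⟨⟨e, he⟩, rfl⟩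
        have he' := he
        rw [← hE] at he'
        refine Subgroup.closure_induction
          (p := fun e _ => rightComm e z ∈ Subgroup.closure ((rightComm · a) '' (θ.range : Set G)))
          ?_ ?_ ?_ ?_ he'
        · rintro _ ⟨q, hq, rfl⟩
          refine Subgroup.subset_closure ⟨rightComm q z, ⟨⟨q, hq⟩, rfl⟩, (hθa q hq).symm⟩
        · simp [rightComm, one_mem]
        · intro x y hx hy h1 h2
          rw [hE] at hx hy
          rw [hmul x hx y hy]
          exact mul_mem h1 h2
        · intro x hx h1
          rw [hE] at hx
          have h4 : rightComm x⁻¹ z = (rightComm x z)⁻¹ := by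
            rw [eq_inv_iff_mul_eq_one, ← hmul _ (E.inv_mem hx) _ hx]
            simp [rightComm]
          rw [h4]
          exact inv_mem h1
      · rintro _ ⟨q, rfl⟩
        exact hzα q
    have h1 : rightComm e z = 1 := by
      have : θ ⟨e, he⟩ ∈ θ.range := ⟨_, rfl⟩
      rwa [hB, Subgroup.mem_bot] at this
    have h2 : e * z = z * e * rightComm e z := by simp [rightComm, mul_assoc]
    rw [h2, h1, mul_one]

end Descent

theorem Set.Finite.exists_forall_ge {ι : Type*} {S : Set ι} (hS : S.Finite) {p : ι → ℕ → Prop}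
    (h : ∀ v ∈ S, ∃ N, ∀ n ≥ N, p v n) : ∃ N, ∀ v ∈ S, ∀ n ≥ N, p v n := by
  simp only [← Filter.eventually_atTop] at h
  obtain ⟨N, hN⟩ := Filter.eventually_atTop.1 ((Filter.eventually_all_finite hS).2 h)
  exact ⟨N, fun v hv n hn => hN n hn v hv⟩

/-! ### Engel sinks and invariant abelian subgroups -/

section Sink

variable {G : Type u} [Group G]

theorem engelComm_add (g x : G) (m n : ℕ) :
    engelComm g x (m + n) = engelComm (engelComm g x m) x n := by
  induction n with
  | zero => rfl
  | succ n ih => rw [← add_assoc, engelComm, ih, engelComm]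

theorem rightComm_mem_of_conj_mem {A : Subgroup G} {a v : G} (hst : ∀ v ∈ A, a⁻¹ * v * a ∈ A)
    (hv : v ∈ A) : rightComm v a ∈ A := by
  simpa [rightComm, mul_assoc] using A.mul_mem (A.inv_mem hv) (hst v hv)

theorem engelComm_mem_of_conj_mem {A : Subgroup G} {a v : G} (hst : ∀ v ∈ A, a⁻¹ * v * a ∈ A)
    (hv : v ∈ A) (n : ℕ) : engelComm v a n ∈ A := by
  induction n with
  | zero => exact hv
  | succ n ih => exact rightComm_mem_of_conj_mem hst ih

section Abelian

variable {A : Subgroup G} {a : G}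

theorem rightComm_mul_left_of_comm (hA : ∀ x ∈ A, ∀ y ∈ A, x * y = y * x)
    (hst : ∀ v ∈ A, a⁻¹ * v * a ∈ A)
    {v w : G} (hv : v ∈ A) (hw : w ∈ A) :
    rightComm (v * w) a = rightComm v a * rightComm w a := by
  have h1 : rightComm (v * w) a = w⁻¹ * (rightComm v a * w) * rightComm w a := by
    simp [rightComm, mul_assoc]
  rw [h1, hA _ (rightComm_mem_of_conj_mem hst hv) _ hw, inv_mul_cancel_left]

theorem engelComm_mul_left_of_comm (hA : ∀ x ∈ A, ∀ y ∈ A, x * y = y * x)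
    (hst : ∀ v ∈ A, a⁻¹ * v * a ∈ A)
    {v w : G} (hv : v ∈ A) (hw : w ∈ A) (n : ℕ) :
    engelComm (v * w) a n = engelComm v a n * engelComm w a n := by
  induction n with
  | zero => rfl
  | succ n ih =>
    rw [engelComm, ih, rightComm_mul_left_of_comm hA hst (engelComm_mem_of_conj_mem hst hv n)
      (engelComm_mem_of_conj_mem hst hw n)]
    rfl

/-- After one commutation everything lies in the abelian `A`, where `a * v` acts as `a` does. This
turns the right Engel condition on `a` into information about iterated commutation by `a`. -/
theorem engelComm_mul_right_of_comm (hA : ∀ x ∈ A, ∀ y ∈ A, x * y = y * x)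
    (hst : ∀ v ∈ A, a⁻¹ * v * a ∈ A)
    {v : G} (hv : v ∈ A) (n : ℕ) :
    engelComm a (a * v) (n + 1) = engelComm v⁻¹ a (n + 1) := by
  have key : ∀ w ∈ A, rightComm w (a * v) = rightComm w a := by
    intro w hw
    have h1 : rightComm w (a * v) = w⁻¹ * (v⁻¹ * ((a⁻¹ * w * a) * v)) := by
      simp [rightComm, mul_assoc]
    rw [h1, hA _ (hst w hw) v hv, inv_mul_cancel_left]
    simp [rightComm, mul_assoc]
  induction n with
  | zero =>
    have h1 : rightComm a (a * v) = (a⁻¹ * v⁻¹ * a) * v := by simp [rightComm, mul_assoc]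
    simp only [engelComm]
    rw [h1, hA _ (hst _ (A.inv_mem hv)) _ hv]
    simp [rightComm, mul_assoc]
  | succ n ih =>
    rw [engelComm, ih, key _ (engelComm_mem_of_conj_mem hst (A.inv_mem hv) _)]
    rfl

theorem IsRightEngelSink.exists_engelComm_mem (hA : ∀ x ∈ A, ∀ y ∈ A, x * y = y * x)
    (hst : ∀ v ∈ A, a⁻¹ * v * a ∈ A)
    {R : Set G} (hR : IsRightEngelSink a R) {v : G}
    (hv : v ∈ A) : ∃ N, ∀ n ≥ N, engelComm v a n ∈ R := by
  obtain ⟨N, hN⟩ := hR (a * v⁻¹)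
  refine ⟨N + 1, fun n hn => ?_⟩
  obtain ⟨n, rfl⟩ := Nat.exists_eq_add_of_le' (by omega : 1 ≤ n)
  have := hN (n + 1) (by omega)
  rwa [engelComm_mul_right_of_comm hA hst (A.inv_mem hv), inv_inv] at this

/-- The elements of an abelian `a`-invariant subgroup that are periodic under taking commutators
with `a` form a finite subgroup, to which every element is carried. -/
theorem exists_finite_periodic (hA : ∀ x ∈ A, ∀ y ∈ A, x * y = y * x)
    (hst : ∀ v ∈ A, a⁻¹ * v * a ∈ A)
    {R : Set G} (hRf : R.Finite) (hR : IsRightEngelSink a R) :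
    ∃ Q ≤ A, Finite Q ∧ (∀ q ∈ Q, ∃ q' ∈ Q, q = rightComm q' a) ∧
      (∀ q ∈ Q, rightComm q a ∈ Q) ∧ ∀ v ∈ A, ∃ n, engelComm v a n ∈ Q := by
  have hmul : ∀ (v : G) (n : ℕ), engelComm v a n = v → ∀ k, engelComm v a (n * k) = v := by
    intro v n h k
    induction k with
    | zero => rfl
    | succ k ih => rw [Nat.mul_succ, engelComm_add, ih, h]
  have h1 : ∀ n, engelComm 1 a n = 1 := by
    intro n
    induction n with
    | zero => rfl
    | succ n ih => simp [engelComm, ih, rightComm]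
  let Q : Subgroup G :=
    { carrier := {v | v ∈ A ∧ ∃ n ≥ 1, engelComm v a n = v}
      one_mem' := ⟨A.one_mem, 1, le_rfl, h1 1⟩
      mul_mem' := by
        rintro v w ⟨hv, m, hm, hvm⟩ ⟨hw, n, hn, hwn⟩
        refine ⟨A.mul_mem hv hw, m * n, Nat.mul_pos hm hn, ?_⟩
        -- The product of the two periods is a common period, and iterated commutation is additive
        -- on `A`.
        rw [engelComm_mul_left_of_comm hA hst hv hw, hmul v m hvm, mul_comm m, hmul w n hwn]
      inv_mem' := by
        rintro v ⟨hv, m, hm, hvm⟩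
        refine ⟨A.inv_mem hv, m, hm, ?_⟩
        rw [eq_inv_iff_mul_eq_one]
        nth_rewrite 2 [← hvm]
        rw [← engelComm_mul_left_of_comm hA hst (A.inv_mem hv) hv, inv_mul_cancel, h1] }
  have hmem : ∀ v, v ∈ Q ↔ v ∈ A ∧ ∃ n ≥ 1, engelComm v a n = v := fun _ => Iff.rfl
  have hper : ∀ v ∈ A, ∀ m n, 1 ≤ n → engelComm v a n = v →
      engelComm (engelComm v a m) a n = engelComm v a m := by
    intro v _ m n _ h
    rw [← engelComm_add, add_comm, engelComm_add, h]
  refine ⟨Q, fun v hv => hv.1, ?_, ?_, ?_, ?_⟩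
  · refine hRf.subset ?_
    rintro v ⟨hv, n, hn, hvn⟩
    obtain ⟨N, hN⟩ := hR.exists_engelComm_mem hA hst hv
    rw [← hmul v n hvn N]
    exact hN _ (Nat.le_mul_of_pos_left N hn)
  · rintro q ⟨hq, n, hn, hqn⟩
    obtain ⟨n, rfl⟩ := Nat.exists_eq_add_of_le' hn
    exact ⟨engelComm q a n, ⟨engelComm_mem_of_conj_mem hst hq n, n + 1, hn,
      hper q hq n _ hn hqn⟩, hqn.symm⟩
  · rintro q ⟨hq, n, hn, hqn⟩
    exact ⟨rightComm_mem_of_conj_mem hst hq, n, hn, hper q hq 1 n hn hqn⟩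
  · intro v hv
    obtain ⟨N, hN⟩ := hR.exists_engelComm_mem hA hst hv
    -- Pigeonhole: the tail of the orbit stays in the finite sink, so it repeats a value and is
    -- periodic from there on, with period `j - i`.
    obtain ⟨i, _, j, _, hij, h⟩ := Set.infinite_univ.exists_lt_map_eq_of_mapsTo
      (f := fun k : ℕ => engelComm v a (N + k)) (t := R) (fun k _ => hN _ (by omega)) hRf
    refine ⟨N + i, engelComm_mem_of_conj_mem hst hv _, j - i, by omega, ?_⟩
    rw [← engelComm_add, h]
    congr 1
    omega

end Abelian

theorem exists_engelComm_eq {E : Subgroup G} {a : G} (h : ∀ e ∈ E, ∃ e' ∈ E, e = rightComm e' a)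
    {e : G} (he : e ∈ E) (n : ℕ) : ∃ e' ∈ E, engelComm e' a n = e := by
  induction n generalizing e with
  | zero => exact ⟨e, he, rfl⟩
  | succ n ih =>
    obtain ⟨e', he', rfl⟩ := h e he
    obtain ⟨e'', he'', rfl⟩ := ih he'
    exact ⟨e'', he'', rfl⟩

theorem finite_closure_of_comm {S : Set G} (hS : S.Finite) (hc : ∀ x ∈ S, ∀ y ∈ S, x * y = y * x)
    (ho : ∀ x ∈ S, IsOfFinOrder x) : Finite (Subgroup.closure S) := by
  have hcomm := Subgroup.isMulCommutative_closure hc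
  let _ : CommGroup (Subgroup.closure S) :=
    { (inferInstance : Group (Subgroup.closure S)) with mul_comm := hcomm.is_comm.comm }
  have : Group.FG (Subgroup.closure S) :=
    (Group.fg_iff_subgroup_fg _).2 ((Subgroup.fg_iff _).2 ⟨S, rfl, hS⟩)
  refine CommGroup.finite_of_fg_isMulTorsion _ ?_
  rintro ⟨x, hx⟩
  rw [← Submonoid.isOfFinOrder_coe]
  change IsOfFinOrder x
  induction hx using Subgroup.closure_induction with
  | mem x hx => exact ho x hx
  | one => exact IsOfFinOrder.one
  | mul x y hx hy h1 h2 =>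
    refine Commute.isOfFinOrder_mul ?_ h1 h2
    exact congrArg Subtype.val (hcomm.is_comm.comm ⟨x, hx⟩ ⟨y, hy⟩)
  | inv x _ h => exact h.inv

/-- For a finite subgroup, one inclusion under conjugation is already an equality. -/
theorem mem_normalizer_closure {S : Set G} [Finite (Subgroup.closure S)] {g : G}
    (h : ∀ s ∈ S, g⁻¹ * s * g ∈ Subgroup.closure S) :
    g ∈ Subgroup.normalizer (Subgroup.closure S : Set G) := by
  rw [← inv_mem_iff]
  refine Subgroup.mem_normalizer_fintype (S := (Subgroup.closure S : Set G)) fun n hn => ?_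
  rw [inv_inv]
  refine Subgroup.closure_induction (p := fun n _ => g⁻¹ * n * g ∈ Subgroup.closure S)
    h ?_ ?_ ?_ hn
  · simp [one_mem]
  · intro x y _ _ hx hy
    simpa [mul_assoc] using mul_mem hx hy
  · intro x _ hx
    simpa [mul_assoc] using inv_mem hx

/-- Commuting with the hypercenter up to a finite `y`-invariant subgroup `P` gives the Engel
condition modulo `P`. -/
theorem exists_engelComm_mem_of_inv_mul_mem_hypercenter {X P : Subgroup G} (hX : X.Normal)
    (hXc : ∀ x ∈ X, ∀ y ∈ X, x * y = y * x) (hPX : P ≤ X) {y : G}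
    (hy : ∀ p ∈ P, y⁻¹ * p * y ∈ P) {p v : G} (hp : p ∈ P) (hv : v ∈ X)
    (hpv : p⁻¹ * v ∈ hypercenter G) : ∃ N, ∀ n ≥ N, engelComm v y n ∈ P := by
  have hXy : ∀ x ∈ X, y⁻¹ * x * y ∈ X := fun x hx => by
    simpa using hX.conj_mem x hx y⁻¹
  obtain ⟨N, hN⟩ := engelComm_mem_of_mem_hypercenter hpv y
  refine ⟨N, fun n hn => ?_⟩
  have h := engelComm_mul_left_of_comm hXc hXy (hPX hp)
    (X.mul_mem (X.inv_mem (hPX hp)) hv) n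
  rw [mul_inv_cancel_left, hN n hn, mul_one] at h
  rw [h]
  exact engelComm_mem_of_conj_mem hy hp n

theorem engelComm_conj (v a g : G) (n : ℕ) :
    engelComm (g⁻¹ * v * g) (g⁻¹ * a * g) n = g⁻¹ * engelComm v a n * g := by
  have := map_engelComm (MulAut.conj g⁻¹).toMonoidHom v a n
  simpa using this.symm

/-- With D/X finite and G/D hypercentral, `E` has finitely many conjugates under D, since the
abelian `X` centralizes it. They generate a finite P normalized by D and `a`. The Engel condition
shows that the core M of the normalizer of P contains every element central modulo M, and
hypercentrality of G/D then gives M = G. -/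
theorem isFiniteByHypercentral_of_abelian {a : G} {X E : Subgroup G} (hX : X.Normal)
    (hXc : ∀ x ∈ X, ∀ y ∈ X, x * y = y * x) (hEX : E ≤ X) [Finite E]
    (hst : ∀ e ∈ E, a⁻¹ * e * a ∈ E) (hsurj : ∀ e ∈ E, ∃ e' ∈ E, e = rightComm e' a)
    (hcov : ∀ x ∈ X, ∃ e ∈ E, e⁻¹ * x ∈ hypercenter G)
    (hquot : ∀ (N : Subgroup G) [N.Normal], E ≤ N → IsFiniteByHypercentral (G ⧸ N)) :
    IsFiniteByHypercentral G := by
  obtain ⟨D, hD, hXD, hXDi, hDM⟩ :=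
    exists_normal_of_isFiniteByHypercentral_quotient X (hquot X hEX)
  let S : Set G := {g | ∃ d ∈ D, ∃ e ∈ E, d⁻¹ * e * d = g}
  have hSX : S ⊆ X := by
    rintro _ ⟨d, _, e, he, rfl⟩
    simpa using hX.conj_mem e (hEX he) d⁻¹
  have hSf : S.Finite := by
    obtain ⟨T, hT, _, hTX⟩ := exists_finite_transversal hXDi
    refine (hT.image2 (fun t e => t⁻¹ * e * t) (Set.toFinite (E : Set G))).subset ?_
    rintro _ ⟨d, hd, e, he, rfl⟩
    obtain ⟨t, ht, hx⟩ := hTX d hd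
    refine ⟨t, ht, e, he, ?_⟩
    have h1 : t⁻¹ * e * t ∈ X := by simpa using hX.conj_mem e (hEX he) t⁻¹
    have h2 : d⁻¹ * e * d = (t⁻¹ * d)⁻¹ * ((t⁻¹ * e * t) * (t⁻¹ * d)) := by
      simp [mul_assoc]
    rw [h2, hXc _ h1 _ hx, inv_mul_cancel_left]
  set P := Subgroup.closure S with hP
  have hPX : P ≤ X := (Subgroup.closure_le X).2 hSX
  have hEP : E ≤ P := fun e he => Subgroup.subset_closure ⟨1, D.one_mem, e, he, by simp⟩
  have hPf : Finite P := by
    refine finite_closure_of_comm hSf (fun x hx y hy => hXc x (hSX hx) y (hSX hy)) ?_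
    rintro _ ⟨d, _, e, he, rfl⟩
    have h1 : IsOfFinOrder e := Submonoid.isOfFinOrder_coe.2 (isOfFinOrder_of_finite (⟨e, he⟩ : E))
    have := (MulAut.conj d⁻¹).toMonoidHom.isOfFinOrder h1
    simpa using this
  set L := Subgroup.normalizer (P : Set G) with hL
  have hLP : ∀ y ∈ L, ∀ p ∈ P, y⁻¹ * p * y ∈ P := fun y hy p hp =>
    (Subgroup.mem_normalizer_iff''.1 hy p).1 hp
  have hDL : D ≤ L := by
    intro d hd
    refine mem_normalizer_closure ?_
    rintro _ ⟨d', hd', e, he, rfl⟩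
    exact Subgroup.subset_closure ⟨d' * d, D.mul_mem hd' hd, e, he, by simp [mul_assoc]⟩
  have haL : a ∈ L := by
    refine mem_normalizer_closure ?_
    rintro _ ⟨d, hd, e, he, rfl⟩
    refine Subgroup.subset_closure ⟨a⁻¹ * d * a, ?_, _, hst e he, by simp [mul_assoc]⟩
    simpa using hD.conj_mem d hd a⁻¹
  have hcore : L.normalCore = ⊤ := by
    by_contra hne
    obtain ⟨g, hgM, hg⟩ := hDM _ inferInstance (Subgroup.normal_le_normalCore.2 hDL) hne
    set M := L.normalCore with hM
    have hML : M ≤ L := Subgroup.normalCore_le L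
    have hC : (Subgroup.center (G ⧸ M)).comap (QuotientGroup.mk' M) ≤ L := by
      intro g hg
      refine mem_normalizer_closure ?_
      rintro _ ⟨d, hd, e, he, rfl⟩
      -- Since `d` is trivial and `g` central modulo `M`, this conjugate of `a` lies in the coset aM
      -- and so normalizes `P`.
      have hy : (d * g)⁻¹ * a * (d * g) ∈ L := by
        have h1 : (d : G ⧸ M) = 1 :=
          (QuotientGroup.eq_one_iff d).2 (Subgroup.normal_le_normalCore.2 hDL hd)
        have h2 : (a : G ⧸ M) * g = g * a := Subgroup.mem_center_iff.1 hg a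
        have h3 : (a : G ⧸ M) = ((d * g)⁻¹ * a * (d * g) : G) := by
          simp [h1, mul_assoc, h2]
        have := L.mul_mem haL (hML (QuotientGroup.eq.1 h3))
        rwa [mul_inv_cancel_left] at this
      obtain ⟨N, hN⟩ := (Set.toFinite (E : Set G)).exists_forall_ge
        (p := fun v n => engelComm ((d * g)⁻¹ * v * (d * g)) ((d * g)⁻¹ * a * (d * g)) n ∈ P)
        (fun v hv => by
          have h1 : (d * g)⁻¹ * v * (d * g) ∈ X := by
            simpa using hX.conj_mem v (hEX hv) (d * g)⁻¹
          obtain ⟨e', he', hc⟩ := hcov _ h1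
          exact exists_engelComm_mem_of_inv_mul_mem_hypercenter hX hXc hPX (hLP _ hy) (hEP he')
            h1 hc)
      -- Since E = [E, a], `e` is itself an `N`-fold commutator with `a`; its conjugate by `d * g`
      -- is thus an `N`-fold commutator with the conjugate of `a`, which lies in `P`.
      obtain ⟨e', he', rfl⟩ := exists_engelComm_eq hsurj he N
      have := hN e' he' N le_rfl
      rw [engelComm_conj] at this
      simpa [mul_assoc] using this
    refine hgM (Subgroup.normal_le_normalCore.2 hC ?_)
    rw [Subgroup.mem_comap, Subgroup.mem_center_iff]
    intro x
    induction x using QuotientGroup.induction_on with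
    | H x => exact ((rightComm_mem_iff M g x).1 (hg x)).symm
  have hLtop : L = ⊤ := top_le_iff.1 (hcore ▸ Subgroup.normalCore_le L)
  have hPn : P.Normal := Subgroup.normalizer_eq_top_iff.1 hLtop
  exact IsFiniteByHypercentral.of_quotient_finite P (hquot P hEP)

end Sink

/-! ### Induction on the size of the sink -/

section Main

open scoped commutatorElement

/-- The hypotheses on `G = H ⟨a⟩`, with a fixed finite right Engel sink `R` of `a`. -/
structure IsEngelExtension {G : Type u} [Group G] (H : Subgroup G) (a : G) (R : Set G) : Prop where
  normal : H.Normal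
  hypercentral : IsHypercentral H
  sup_eq_top : H ⊔ Subgroup.zpowers a = ⊤
  finite : R.Finite
  sink : IsRightEngelSink a R

variable {G G' : Type u} [Group G] [Group G']

theorem IsEngelExtension.map {H : Subgroup G} {a : G} {R : Set G} (h : IsEngelExtension H a R)
    {f : G →* G'} (hf : Function.Surjective f) : IsEngelExtension (H.map f) (f a) (f '' R) where
  normal := h.normal.map f hf
  hypercentral := h.hypercentral.of_surjective (f.subgroupMap_surjective H)
  sup_eq_top := by
    rw [← MonoidHom.map_zpowers, ← Subgroup.map_sup, h.sup_eq_top,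
      Subgroup.map_top_of_surjective f hf]
  finite := h.finite.image f
  sink := by
    intro y
    obtain ⟨x, rfl⟩ := hf y
    obtain ⟨N, hN⟩ := h.sink x
    exact ⟨N, fun n hn => ⟨_, hN n hn, map_engelComm f a x n⟩⟩

theorem image_diff_one_subset (f : G →* G') (R : Set G) : f '' R \ {1} ⊆ f '' (R \ {1}) := by
  rintro _ ⟨⟨r, hr, rfl⟩, h⟩
  refine ⟨r, ⟨hr, fun h1 => h ?_⟩, rfl⟩
  rw [Set.mem_singleton_iff] at h1
  simp [h1]

theorem ncard_image_diff_one_le (f : G →* G') {R : Set G} (hR : R.Finite) :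
    (f '' R \ {1}).ncard ≤ (R \ {1}).ncard :=
  (Set.ncard_le_ncard (image_diff_one_subset f R) (hR.sdiff.image f)).trans
    (Set.ncard_image_le hR.sdiff)

theorem ncard_image_diff_one_lt (f : G →* G') {R : Set G} (hR : R.Finite) {r : G} (hr : r ∈ R)
    (hr1 : r ≠ 1) (hfr : f r = 1) : (f '' R \ {1}).ncard < (R \ {1}).ncard := by
  have hsub : f '' R \ {1} ⊆ f '' ((R \ {1}) \ {r}) := by
    intro y hy
    obtain ⟨s, hs, rfl⟩ := image_diff_one_subset f R hy
    refine ⟨s, ⟨hs, fun h => hy.2 ?_⟩, rfl⟩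
    rw [Set.mem_singleton_iff] at h
    rw [h, hfr]
    rfl
  calc _ ≤ (f '' ((R \ {1}) \ {r})).ncard :=
        Set.ncard_le_ncard hsub (hR.sdiff.sdiff.image f)
    _ ≤ ((R \ {1}) \ {r}).ncard := Set.ncard_image_le hR.sdiff.sdiff
    _ < _ := Set.ncard_sdiff_singleton_lt_of_mem ⟨hr, hr1⟩ hR.sdiff

/-- In a nontrivial centerless extension there is a nontrivial finite abelian normal subgroup
on which taking commutators with `a` is surjective. -/
theorem IsEngelExtension.exists_finite_normal {H : Subgroup G} {a : G} {R : Set G}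
    (h : IsEngelExtension H a R) [Nontrivial G] (hc : Subgroup.center G = ⊥) :
    ∃ Q : Subgroup G, Q.Normal ∧ Finite Q ∧ Q ≠ ⊥ ∧ (∀ x ∈ Q, ∀ y ∈ Q, x * y = y * x) ∧
      ∀ q ∈ Q, ∃ q' ∈ Q, q = rightComm q' a := by
  have hHn := h.normal
  have hcenter : ∀ z, z ∈ Subgroup.centralizer (H : Set G) → z * a = a * z → z = 1 := by
    intro z hz hza
    have hle : H ⊔ Subgroup.zpowers a ≤ Subgroup.centralizer {z} := by
      rw [sup_le_iff, Subgroup.zpowers_le]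
      constructor
      · intro x hx
        rw [Subgroup.mem_centralizer_singleton_iff]
        exact Subgroup.mem_centralizer_iff.1 hz x hx
      · rw [Subgroup.mem_centralizer_singleton_iff]
        exact hza.symm
    rw [h.sup_eq_top] at hle
    have : z ∈ Subgroup.center G := Subgroup.mem_center_iff.2 fun g =>
      (Subgroup.mem_centralizer_singleton_iff.1 (hle (Subgroup.mem_top g)))
    rwa [hc, Subgroup.mem_bot] at this
  set A := H ⊓ Subgroup.centralizer (H : Set G) with hAdef
  have hA : ∀ x ∈ A, ∀ y ∈ A, x * y = y * x := fun x hx y hy =>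
    Subgroup.mem_centralizer_iff.1 hy.2 x hx.1
  have hAn : A.Normal := inferInstance
  have hst : ∀ v ∈ A, a⁻¹ * v * a ∈ A := fun v hv => by simpa using hAn.conj_mem v hv a⁻¹
  have hAbot : ∃ v ∈ A, v ≠ 1 := by
    have hH : (⊥ : Subgroup H) ≠ ⊤ := by
      intro hbot
      have hHbot : H = ⊥ := by
        rw [eq_bot_iff]
        intro x hx
        have : (⟨x, hx⟩ : H) ∈ (⊥ : Subgroup H) := hbot ▸ Subgroup.mem_top _
        simpa using this
      have htop := h.sup_eq_top
      rw [hHbot, bot_sup_eq] at htop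
      -- If `H` were trivial, `G` would be cyclic and centerless, hence trivial.
      have ha1 : a = 1 := hcenter a (by rw [hHbot, Subgroup.mem_centralizer_iff]; simp) rfl
      rw [ha1, Subgroup.zpowers_one_eq_bot] at htop
      exact bot_ne_top htop
    obtain ⟨g, hg, hx⟩ := isHypercentral_iff.1 h.hypercentral ⊥ inferInstance hH
    refine ⟨g, ⟨g.2, Subgroup.mem_centralizer_iff.2 ?_⟩,
      fun h1 => hg (Subgroup.mem_bot.2 (Subtype.ext h1))⟩
    intro x hxH
    have h1 := congrArg Subtype.val (Subgroup.mem_bot.1 (hx ⟨x, hxH⟩))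
    have h2 : (g : G) * x = x * g * ((g : G)⁻¹ * x⁻¹ * g * x) := by simp [mul_assoc]
    have h3 : (g : G)⁻¹ * x⁻¹ * g * x = 1 := h1
    rw [h2, h3, mul_one]
  obtain ⟨Q, hQA, hQf, hQs, hQst, hQe⟩ := exists_finite_periodic hA hst h.finite h.sink
  refine ⟨Q, ?_, hQf, ?_, fun x hx y hy => hA x (hQA hx) y (hQA hy), hQs⟩
  · rw [← Subgroup.normalizer_eq_top_iff, ← top_le_iff, ← h.sup_eq_top, sup_le_iff,
      Subgroup.zpowers_le]
    constructor
    · intro x hx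
      refine Subgroup.mem_normalizer_fintype fun q hq => ?_
      rw [Subgroup.mem_centralizer_iff.1 (hQA hq).2 x hx, mul_inv_cancel_right]
      exact hq
    · rw [← inv_mem_iff]
      refine Subgroup.mem_normalizer_fintype fun q hq => ?_
      have := Q.mul_mem hq (hQst q hq)
      simpa [rightComm, mul_assoc] using this
  -- If `Q` were trivial, every orbit in `A` would reach 1; the last nontrivial member commutes with
  -- `a` and with `H`, so it would be central.
  · intro hbot
    obtain ⟨v, hv, hv1⟩ := hAbot
    obtain ⟨n, hn⟩ := hQe v hv
    rw [hbot, Subgroup.mem_bot] at hn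
    induction n with
    | zero => exact hv1 hn
    | succ n ih =>
      have hw := engelComm_mem_of_conj_mem hst hv n
      refine ih (hcenter _ hw.2 ?_)
      have h2 : engelComm v a n * a = a * engelComm v a n * rightComm (engelComm v a n) a := by
        simp [rightComm, mul_assoc]
      rw [h2]
      change rightComm (engelComm v a n) a = 1 at hn
      rw [hn, mul_one]

theorem center_quotient_hypercenter_eq_bot : Subgroup.center (G ⧸ hypercenter G) = ⊥ := by
  rw [eq_bot_iff]
  intro x hx
  induction x using QuotientGroup.induction_on with
  | H x =>
    rw [Subgroup.mem_bot, QuotientGroup.eq_one_iff]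
    refine mem_hypercenter_of_rightComm_mem fun y => ?_
    rw [rightComm_mem_iff]
    exact (Subgroup.mem_center_iff.1 hx y).symm

theorem IsEngelExtension.isFiniteByHypercentral {H : Subgroup G} {a : G} {R : Set G}
    (h : IsEngelExtension H a R) : IsFiniteByHypercentral G := by
  induction hn : (R \ {1}).ncard using Nat.strong_induction_on generalizing G with
  | _ n IH =>
  set K := hypercenter G with hK
  set f := QuotientGroup.mk' K with hf
  have hfs : Function.Surjective f := QuotientGroup.mk'_surjective K
  have hfK : ∀ x, f x = 1 ↔ x ∈ K := fun x => QuotientGroup.eq_one_iff x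
  by_cases hKtop : K = ⊤
  · exact ⟨⊥, inferInstance, inferInstance,
      IsHypercentral.of_surjective (QuotientGroup.mk'_surjective _) hKtop⟩
  have hnt : Nontrivial (G ⧸ K) := QuotientGroup.nontrivial_iff.2 hKtop
  obtain ⟨Q, hQn, hQf, hQ1, hQc, hQs⟩ :=
    (h.map hfs).exists_finite_normal center_quotient_hypercenter_eq_bot
  set X := Q.comap f with hX
  have hXn : X.Normal := inferInstance
  have hstn : ∀ {N : Subgroup G}, N.Normal → ∀ x ∈ N, a⁻¹ * x * a ∈ N := fun hN x hx => by
    simpa using hN.conj_mem x hx a⁻¹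
  obtain ⟨E, hEX, hEf, hEst, hEcov, hEcl⟩ := exists_finite_eq_closure_rightComm (X := X) (a := a)
    (le_comap_mk K Q) (by
      intro x hx
      obtain ⟨q', hq', h1⟩ := hQs (f x) hx
      obtain ⟨y, rfl⟩ := hfs q'
      refine ⟨y, hq', ?_⟩
      rw [← map_rightComm] at h1
      exact QuotientGroup.eq.1 h1) (relIndex_comap_mk_ne_zero K Q) (hstn hXn)
  have hEK : ∀ e ∈ E, ∀ z ∈ K, e * z = z * e := fun e he z hz =>
    commute_of_eq_closure_rightComm hEst hEcl hz he
  -- the derived subgroup of `E` is normal in `G`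
  set X₁ := X ⊓ Subgroup.centralizer (K : Set G) with hX₁
  have hX₁n : X₁.Normal := inferInstance
  have hEX₁ : E ≤ X₁ := fun e he =>
    ⟨hEX he, Subgroup.mem_centralizer_iff.2 fun z hz => (hEK e he z hz).symm⟩
  have hdec : ∀ x ∈ X₁, ∃ e ∈ E, ∃ k ∈ K, x = e * k ∧ ∀ z ∈ K, z * k = k * z := by
    intro x hx
    obtain ⟨e, he, hk⟩ := hEcov x hx.1
    refine ⟨e, he, _, hk, by simp, fun z hz => ?_⟩
    exact Subgroup.mem_centralizer_iff.1 (X₁.mul_mem (X₁.inv_mem (hEX₁ he)) hx).2 z hz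
  -- The `K`-parts of elements of `X₁` commute with `E` and with each other, so they drop out of
  -- commutators.
  have hcomm : ⁅X₁, X₁⁆ = ⁅E, E⁆ := by
    refine le_antisymm (Subgroup.commutator_le.2 ?_) (Subgroup.commutator_mono hEX₁ hEX₁)
    intro x hx y hy
    obtain ⟨e, he, k, hk, rfl, hkz⟩ := hdec x hx
    obtain ⟨e', he', l, hl, rfl, hlz⟩ := hdec y hy
    have h1 : ⁅e * k, e' * l⁆ = ⁅e, e'⁆ := by
      simp only [commutatorElement_def, mul_inv_rev]
      calc e * k * (e' * l) * (k⁻¹ * e⁻¹) * (l⁻¹ * e'⁻¹)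
          = e * (k * e') * (l * k⁻¹) * (e⁻¹ * l⁻¹) * e'⁻¹ := by group
        _ = e * (e' * k) * (k⁻¹ * l) * (l⁻¹ * e⁻¹) * e'⁻¹ := by
          rw [hEK e' he' k hk, hlz _ (K.inv_mem hk), hEK _ (E.inv_mem he) _ (K.inv_mem hl)]
        _ = e * e' * e⁻¹ * e'⁻¹ := by group
    rw [h1]
    exact Subgroup.commutator_mem_commutator he he'
  set N := ⁅E, E⁆ with hN
  have hNn : N.Normal := by rw [← hcomm]; infer_instance
  have hNE : N ≤ E := Subgroup.commutator_le.2 fun x hx y hy =>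
    E.mul_mem (E.mul_mem (E.mul_mem hx hy) (E.inv_mem hx)) (E.inv_mem hy)
  have hNf : Finite N := (Set.toFinite (E : Set G)).subset hNE
  have hNK : N ≤ K := Subgroup.commutator_le.2 fun x hx y hy => by
    rw [← hfK, map_commutatorElement, commutatorElement_eq_one_iff_mul_comm]
    exact hQc _ (hEX hx) _ (hEX hy)
  have hENK : ∃ e ∈ E, e ∉ K := by
    by_contra! hle
    apply hQ1
    rw [eq_bot_iff]
    intro q hq
    obtain ⟨x, rfl⟩ := hfs q
    obtain ⟨e, he, hk⟩ := hEcov x hq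
    have := K.mul_mem (hle e he) hk
    rw [mul_inv_cancel_left] at this
    exact Subgroup.mem_bot.2 ((hfK x).2 this)
  refine IsFiniteByHypercentral.of_quotient_finite N ?_
  set g := QuotientGroup.mk' N with hg
  have hgs : Function.Surjective g := QuotientGroup.mk'_surjective N
  have hext := h.map hgs
  have hgc : ∀ x ∈ X₁, ∀ y ∈ X₁, g x * g y = g y * g x := by
    intro x hx y hy
    rw [← commutatorElement_eq_one_iff_mul_comm, ← map_commutatorElement]
    refine (QuotientGroup.eq_one_iff _).2 ?_
    rw [← hcomm]
    exact Subgroup.commutator_mem_commutator hx hy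
  have hX₁c : ∀ x ∈ X₁.map g, ∀ y ∈ X₁.map g, x * y = y * x := by
    rintro _ ⟨x, hx, rfl⟩ _ ⟨y, hy, rfl⟩
    exact hgc x hx y hy
  have hEle : E.map g ≤ X₁.map g := Subgroup.map_mono hEX₁
  have hEfin : Finite (E.map g) := (Set.toFinite (E : Set G)).image g
  have hEstg : ∀ e ∈ E.map g, (g a)⁻¹ * e * g a ∈ E.map g := by
    rintro _ ⟨e, he, rfl⟩
    exact ⟨_, hEst e he, by simp⟩
  have hEc : ∀ x ∈ E.map g, ∀ y ∈ E.map g, x * y = y * x := fun x hx y hy =>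
    hX₁c x (hEle hx) y (hEle hy)
  have hEsurj : ∀ e ∈ E.map g, ∃ e' ∈ E.map g, e = rightComm e' (g a) := by
    rintro _ ⟨e, he, rfl⟩
    have he' : e ∈ Subgroup.closure ((rightComm · a) '' (E : Set G)) := hEcl.symm ▸ he
    clear he
    induction he' using Subgroup.closure_induction with
    | mem x hx =>
      obtain ⟨e, he, rfl⟩ := hx
      exact ⟨g e, ⟨e, he, rfl⟩, map_rightComm g e a⟩
    | one => exact ⟨1, one_mem _, by simp [rightComm]⟩
    | mul x y _ _ hx hy =>
      obtain ⟨x', hx', h1⟩ := hx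
      obtain ⟨y', hy', h2⟩ := hy
      refine ⟨x' * y', mul_mem hx' hy', ?_⟩
      rw [map_mul, h1, h2, rightComm_mul_left_of_comm hEc hEstg hx' hy']
    | inv x _ hx =>
      obtain ⟨x', hx', h1⟩ := hx
      refine ⟨x'⁻¹, inv_mem hx', ?_⟩
      rw [map_inv, h1, inv_eq_iff_mul_eq_one,
        ← rightComm_mul_left_of_comm hEc hEstg hx' (inv_mem hx')]
      simp [rightComm]
  refine isFiniteByHypercentral_of_abelian (a := g a) (hX₁n.map g hgs) hX₁c hEle hEstg hEsurj
    ?_ ?_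
  · rintro _ ⟨x, hx, rfl⟩
    obtain ⟨e, he, k, hk, rfl, -⟩ := hdec x hx
    refine ⟨g e, ⟨e, he, rfl⟩, ?_⟩
    rw [map_mul, inv_mul_cancel_left]
    exact hypercenter_le_comap hgs hk
  · intro M hM hEM
    obtain ⟨e, he, heK⟩ := hENK
    -- As `N` lies in `K`, `e` survives modulo `N`. Its image is an arbitrarily long commutator with
    -- `a`, hence a nontrivial sink element; passing to the quotient by `M` kills it, so the count
    -- drops.
    have hge : g e ≠ 1 := fun h1 => heK (hNK ((QuotientGroup.eq_one_iff e).1 h1))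
    obtain ⟨m, hm⟩ := (Set.toFinite ((E.map g : Subgroup (G ⧸ N)) : Set (G ⧸ N))).exists_forall_ge
      fun v hv => hext.sink.exists_engelComm_mem hEc hEstg hv
    obtain ⟨e', he', h1⟩ := exists_engelComm_eq hEsurj ⟨e, he, rfl⟩ m
    have hR : g e ∈ g '' R := by
      have := hm e' he' m le_rfl
      rwa [h1] at this
    refine IH _ ?_ (hext.map (QuotientGroup.mk'_surjective M)) rfl
    rw [← hn]
    exact (ncard_image_diff_one_lt _ hext.finite hR hge
      ((QuotientGroup.eq_one_iff _).2 (hEM ⟨e, he, rfl⟩))).trans_le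
      (ncard_image_diff_one_le g h.finite)

end Main

theorem proposition3 {G : Type u} [Group G] (H : Subgroup G) (hH : H.Normal)
    (hyp : IsHypercentral H) (a : G) (ha : IsAlmostRightEngel a)
    (hG : H ⊔ Subgroup.zpowers a = ⊤) :
    IsFiniteByHypercentral G := by
  obtain ⟨R, hRf, hR⟩ := ha
  exact IsEngelExtension.isFiniteByHypercentral ⟨hH, hyp, hG, hRf, hR⟩
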